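/- Let $\Gamma=(V,E)$ be a finite simple graph, and identify every edge $e\in E$ with the interval $[0,1]$, so that the parameter values $0$ and $1$ correspond to the two end points $e^-$ and $e^+$ of $e$ (in an arbitrary but fixed order). Let $Y\subseteq\mathbb C^E\times\mathbb C^E$ be the space of all pairs $\big((\varphi(e^-))_{e\in E},(\varphi(e^+))_{e\in E}\big)$ with $\varphi:V\to\mathbb C$, and let $Y^\perp$ be its orthogonal complement. Let $\Delta^{CK}$ (continuity and Kirchhoff conditions) and $\Delta^{KC}$ (anti-Kirchhoff conditions) be the operators $u\mapsto u''$ from their domains $$D(\Delta^{CK})=\{u\in C^2([0,1];\mathbb C^E) : (u(0),u(1))\in Y,\ (-u'(0),u'(1))\in Y^\perp\},$$ $$D(\Delta^{KC})=\{u\in C^2([0,1];\mathbb C^E) : (u(0),u(1))\in Y^\perp,\ (-u'(0),u'(1))\in Y\}$$ to $C([0,1];\mathbb C^E)$. Call an eigenvalue $\lambda$ of $-\Delta^{CK}$ or of $-\Delta^{KC}$ immanent if $\sin\sqrt\lambda\neq 0$, and let its multiplicity be the dimension of its eigenspace. Then $\Gamma$ is bipartite if and only if $-\Delta^{CK}$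 and $-\Delta^{KC}$ have the same immanent eigenvalues with the same multiplicities. -/

import Mathlib

/-- The realization of a simple graph as a network: every edge `e` is identified with the interval
`[0, 1]`, the parameter `0` being glued to the vertex `tail e` and `1` to the vertex `head e`.
This is the choice of an orientation of every edge. -/
structure EdgeParametrization {V : Type*} (G : SimpleGraph V) where
  tail : G.edgeSet → V
  head : G.edgeSet → V
  ends_eq : ∀ e : G.edgeSet, s(tail e, head e) = (e : Sym2 V)

namespace Network

open Set

noncomputable section

section Abstract

variable {H : Type*} [NormedAddCommGroup H] [InnerProductSpace ℂ H]

/-- A continuous function on `[0, 1]`, extended by constants to the real line. Only the values on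
`[0, 1]` matter below: all derivatives are taken within `[0, 1]`. -/
def extend (u : C(unitInterval, H)) : ℝ → H := IccExtend (zero_le_one' ℝ) u

/-- The first derivative of `u` at `x ∈ [0, 1]` (one-sided at the end points). -/
def deriv₁ (u : C(unitInterval, H)) (x : ℝ) : H := derivWithin (extend u) (Icc 0 1) x

/-- The second derivative of `u` at `x ∈ [0, 1]` (one-sided at the end points). -/
def deriv₂ (u : C(unitInterval, H)) (x : ℝ) : H := derivWithin (deriv₁ u) (Icc 0 1) x

/-- `u` is twice continuously differentiable on the closed interval `[0, 1]`. -/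
def IsC2 (u : C(unitInterval, H)) : Prop := ContDiffOn ℝ 2 (extend u) (Icc 0 1)

theorem extend_add (u v : C(unitInterval, H)) : extend (u + v) = extend u + extend v := rfl

theorem extend_smul (c : ℂ) (u : C(unitInterval, H)) : extend (c • u) = c • extend u := rfl

theorem extend_zero : extend (0 : C(unitInterval, H)) = fun _ => 0 := rfl

theorem IsC2.diff {u : C(unitInterval, H)} (hu : IsC2 u) :
    DifferentiableOn ℝ (extend u) (Icc 0 1) := hu.differentiableOn (by norm_num)

theorem IsC2.contDiff_deriv {u : C(unitInterval, H)} (hu : IsC2 u) :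
    ContDiffOn ℝ 1 (deriv₁ u) (Icc 0 1) :=
  ContDiffOn.derivWithin hu (uniqueDiffOn_Icc zero_lt_one) (by norm_num)

theorem IsC2.continuous_deriv₂ {u : C(unitInterval, H)} (hu : IsC2 u) :
    ContinuousOn (deriv₂ u) (Icc 0 1) :=
  hu.contDiff_deriv.continuousOn_derivWithin (uniqueDiffOn_Icc zero_lt_one) (by norm_num)

theorem deriv₁_add {u v : C(unitInterval, H)} (hu : IsC2 u) (hv : IsC2 v) {x : ℝ}
    (hx : x ∈ Icc (0 : ℝ) 1) : deriv₁ (u + v) x = deriv₁ u x + deriv₁ v x := by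
  rw [deriv₁, extend_add]
  exact derivWithin_add (hu.diff x hx) (hv.diff x hx)

theorem deriv₁_smul (c : ℂ) (u : C(unitInterval, H)) (x : ℝ) :
    deriv₁ (c • u) x = c • deriv₁ u x := by
  rw [deriv₁, extend_smul]
  exact derivWithin_const_smul_field c _

theorem deriv₁_zero (x : ℝ) : deriv₁ (0 : C(unitInterval, H)) x = 0 := by
  rw [deriv₁, extend_zero]; simp

theorem deriv₂_add {u v : C(unitInterval, H)} (hu : IsC2 u) (hv : IsC2 v) {x : ℝ}
    (hx : x ∈ Icc (0 : ℝ) 1) : deriv₂ (u + v) x = deriv₂ u x + deriv₂ v x := by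
  rw [deriv₂, derivWithin_congr (f := deriv₁ u + deriv₁ v)
    (fun y hy => deriv₁_add hu hv hy) (deriv₁_add hu hv hx)]
  exact derivWithin_add (hu.contDiff_deriv.differentiableOn (by norm_num) x hx)
    (hv.contDiff_deriv.differentiableOn (by norm_num) x hx)

theorem deriv₂_smul (c : ℂ) (u : C(unitInterval, H)) (x : ℝ) :
    deriv₂ (c • u) x = c • deriv₂ u x := by
  have h : deriv₁ (c • u) = c • deriv₁ u := funext (deriv₁_smul c u)
  rw [deriv₂, h]
  exact derivWithin_const_smul_field c _

/-- The boundary values `(u(0), u(1))` in the Hilbert space `H × H`. -/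
def boundaryValues (u : C(unitInterval, H)) : WithLp 2 (H × H) := WithLp.toLp 2 (u 0, u 1)

/-- The outer normal derivatives `(-u'(0), u'(1))` in the Hilbert space `H × H`. -/
def boundaryDerivs (u : C(unitInterval, H)) : WithLp 2 (H × H) :=
  WithLp.toLp 2 (-deriv₁ u 0, deriv₁ u 1)

theorem boundaryDerivs_add {u v : C(unitInterval, H)} (hu : IsC2 u) (hv : IsC2 v) :
    boundaryDerivs (u + v) = boundaryDerivs u + boundaryDerivs v := by
  rw [boundaryDerivs, deriv₁_add hu hv (by simp), deriv₁_add hu hv (by simp), neg_add]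
  rfl

theorem boundaryDerivs_smul (c : ℂ) (u : C(unitInterval, H)) :
    boundaryDerivs (c • u) = c • boundaryDerivs u := by
  rw [boundaryDerivs, deriv₁_smul, deriv₁_smul, ← smul_neg]
  rfl

/-- The functions in `C²([0, 1]; H)` that satisfy the boundary conditions
`(u(0), u(1)) ∈ Y` and `(-u'(0), u'(1)) ∈ Yᗮ`. -/
def domain (Y : Submodule ℂ (WithLp 2 (H × H))) : Submodule ℂ C(unitInterval, H) where
  carrier := {u | IsC2 u ∧ boundaryValues u ∈ Y ∧ boundaryDerivs u ∈ Yᗮ}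
  zero_mem' := by
    refine ⟨contDiffOn_const, ?_, ?_⟩
    · exact Y.zero_mem
    · rw [boundaryDerivs, deriv₁_zero, deriv₁_zero, neg_zero]
      exact Yᗮ.zero_mem
  add_mem' := by
    rintro u v ⟨hu, hu0, hu1⟩ ⟨hv, hv0, hv1⟩
    refine ⟨ContDiffOn.add hu hv, Y.add_mem hu0 hv0, ?_⟩
    rw [boundaryDerivs_add hu hv]
    exact Yᗮ.add_mem hu1 hv1
  smul_mem' := by
    rintro c u ⟨hu, hu0, hu1⟩
    refine ⟨ContDiffOn.const_smul c hu, Y.smul_mem c hu0, ?_⟩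
    rw [boundaryDerivs_smul]
    exact Yᗮ.smul_mem c hu1

/-- The second derivative `u ↦ u''` from `domain Y ⊆ C²([0, 1]; H)` to `C([0, 1]; H)`. -/
def laplacian (Y : Submodule ℂ (WithLp 2 (H × H))) :
    C(unitInterval, H) →ₗ.[ℂ] C(unitInterval, H) where
  domain := domain Y
  toFun :=
    { toFun := fun u => ⟨fun x => deriv₂ u.1 x, u.2.1.continuous_deriv₂.domRestrict⟩
      map_add' := fun u v => ContinuousMap.ext fun x => deriv₂_add u.2.1 v.2.1 x.2
      map_smul' := fun c u => ContinuousMap.ext fun x => deriv₂_smul c u.1 x }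

end Abstract

section Spectrum

variable {X : Type*} [AddCommGroup X] [Module ℂ X]

/-- The eigenspace `{u ∈ D(T) | T u = μ u}` of an operator `T` with domain `D(T) ⊆ X`. -/
def eigenspace (T : X →ₗ.[ℂ] X) (μ : ℂ) : Submodule ℂ T.domain :=
  LinearMap.ker (T.toFun - μ • T.domain.subtype)

/-- The multiplicity of `μ`: the dimension of its eigenspace, as a cardinal number. -/
def multiplicity (T : X →ₗ.[ℂ] X) (μ : ℂ) : Cardinal := Module.rank ℂ (eigenspace T μ)

/-- The immanent eigenvalues: the eigenvalues `μ` with `sin √μ ≠ 0`. Whether `sin √μ` vanishes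
does not depend on the branch of the square root. -/
def immanentEigenvalues (T : X →ₗ.[ℂ] X) : Set ℂ :=
  {μ | eigenspace T μ ≠ ⊥ ∧ Complex.sin (Complex.sqrt μ) ≠ 0}

end Spectrum

section Graph

variable {V : Type*} {G : SimpleGraph V} [Fintype G.edgeSet]

/-- The linear map that sends a function `φ` on the vertices to its values
`((φ (tail e))ₑ, (φ (head e))ₑ)` at the initial and at the terminal ends of the edges. In terms of
the signed incidence matrix `D` (with entry `1` at `head e` and `-1` at `tail e`), it is the block
matrix with the blocks `(D⁻)ᵀ` and `(D⁺)ᵀ`, where `D⁺` and `D⁻` consist of the positive and of the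
negative parts of the entries. -/
def endValues (P : EdgeParametrization G) :
    (V → ℂ) →ₗ[ℂ] WithLp 2 (EuclideanSpace ℂ G.edgeSet × EuclideanSpace ℂ G.edgeSet) where
  toFun φ := WithLp.toLp 2
    (WithLp.toLp 2 fun e => φ (P.tail e), WithLp.toLp 2 fun e => φ (P.head e))
  map_add' _ _ := rfl
  map_smul' _ _ := rfl

/-- The Laplacian under the continuity and Kirchhoff conditions: the boundary values come from a
function on the vertices, and at every vertex the outer normal derivatives sum to zero. -/
def laplacianCK (P : EdgeParametrization G) :
    C(unitInterval, EuclideanSpace ℂ G.edgeSet) →ₗ.[ℂ]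
      C(unitInterval, EuclideanSpace ℂ G.edgeSet) :=
  laplacian (LinearMap.range (endValues P))

/-- The Laplacian under the dual (anti-Kirchhoff) conditions: at every vertex the boundary values
sum to zero, and the outer normal derivatives come from a function on the vertices. -/
def laplacianKC (P : EdgeParametrization G) :
    C(unitInterval, EuclideanSpace ℂ G.edgeSet) →ₗ.[ℂ]
      C(unitInterval, EuclideanSpace ℂ G.edgeSet) :=
  laplacian (LinearMap.range (endValues P))ᗮ

end Graph

end

end Network

/-! An eigenfunction of `-Δ` at `μ = s ^ 2` is a combination of `cos (s x)` and `sin (s x)`, so for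
`sin s ≠ 0` it is determined by its boundary values. For `Δ^{CK}` these range over the eigenspace
at `cos s` of the compression to `Y` of the exchange `J` of the two ends of every edge; this
compression is the transition operator of the random walk on `G`. For `Δ^{KC}` the space `Y` is
replaced by `Yᗮ`, and `J - c` turns the eigenspace at `c` of the compression to `Yᗮ` into the one
at `-c` of the compression to `Y`. Hence the immanent spectra agree if and only if the spectrum of
the transition operator is symmetric away from `±1`. A bipartition provides such a symmetry.
Conversely, the transition operator has trace `0`, so that its eigenvalues `1` and `-1` then have
the same multiplicity as well, and this means that the vertices of every connected component with
an edge can be given signs that alternate along the edges.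
-/

theorem EdgeParametrization.adj {V : Type*} {G : SimpleGraph V} (P : EdgeParametrization G)
    (e : G.edgeSet) : G.Adj (P.tail e) (P.head e) := by
  rw [← SimpleGraph.mem_edgeSet, P.ends_eq]
  exact e.2

theorem EdgeParametrization.exists_edge {V : Type*} {G : SimpleGraph V} (P : EdgeParametrization G)
    {v w : V} (h : G.Adj v w) :
    ∃ e, (P.tail e = v ∧ P.head e = w) ∨ (P.tail e = w ∧ P.head e = v) :=
  ⟨⟨s(v, w), h⟩, Sym2.eq_iff.1 (P.ends_eq ⟨s(v, w), h⟩)⟩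

namespace Network

open Module Set

noncomputable section

section Rank

variable {R M : Type*} [Ring R] [AddCommGroup M] [Module R M]

theorem rank_le_rank_of_mapsTo_of_disjoint_ker {p q : Submodule R M} (f : End R M)
    (hf : MapsTo f p q) (hker : Disjoint p f.ker) : Module.rank R p ≤ Module.rank R q :=
  LinearMap.rank_le_of_injective (f.restrict hf) ((LinearMap.injective_restrict_iff hf).2 hker)

end Rank

section Compression

variable {𝕜 K : Type*} [RCLike 𝕜] [NormedAddCommGroup K] [InnerProductSpace 𝕜 K]
  {J : End 𝕜 K} {Y : Submodule 𝕜 K} {c : 𝕜}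

/-- The eigenvectors at `c` of the compression of `J` to `Y`, described without the orthogonal
projection onto `Y`, so that the definition makes sense when `Y` is not complete. -/
def compressedEigenspace (J : End 𝕜 K) (Y : Submodule 𝕜 K) (c : 𝕜) : Submodule 𝕜 K :=
  Y ⊓ Yᗮ.comap (J - c • LinearMap.id)

theorem mem_compressedEigenspace {y : K} :
    y ∈ compressedEigenspace J Y c ↔ y ∈ Y ∧ J y - c • y ∈ Yᗮ := Iff.rfl

theorem mem_compressedEigenspace_of_sq_eq_one (hJ : ∀ y, J (J y) = y) (hsymm : J.IsSymmetric)
    (hc : c ^ 2 = 1) {y : K} : y ∈ compressedEigenspace J Y c ↔ y ∈ Y ∧ J y = c • y := by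
  rw [mem_compressedEigenspace]
  refine and_congr_right fun hy => ⟨fun h => ?_, fun h => by rw [h, sub_self]; exact zero_mem _⟩
  have horth : inner 𝕜 (J y - c • y) y = 0 := (Submodule.mem_orthogonal' _ _).1 h y hy
  have heigen : J (J y - c • y) = -c • (J y - c • y) := by
    rw [map_sub, map_smul, hJ, smul_sub, smul_smul, neg_mul, ← sq, hc]
    module
  rw [← sub_eq_zero, ← inner_self_eq_zero (𝕜 := 𝕜), inner_sub_right, inner_smul_right, horth,
    mul_zero, sub_zero, ← hsymm, heigen, inner_smul_left, horth, mul_zero]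

-- `J - c` maps one space into the other, and `(J + c) (J - c) = 1 - c ^ 2` is invertible.
theorem rank_compressedEigenspace_le_orthogonal (hJ : ∀ y, J (J y) = y) (hc : c ^ 2 ≠ 1) :
    Module.rank 𝕜 (compressedEigenspace J Y c) ≤
      Module.rank 𝕜 (compressedEigenspace J Yᗮ (-c)) := by
  have hfactor (y : K) : J (J y - c • y) - -c • (J y - c • y) = (1 - c ^ 2) • y := by
    rw [map_sub, map_smul, hJ]
    module
  refine rank_le_rank_of_mapsTo_of_disjoint_ker (J - c • LinearMap.id) (fun y hy => ⟨hy.2, ?_⟩)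
    (LinearMap.disjoint_ker.2 fun y _ (h : J y - c • y = 0) => ?_)
  · change J (J y - c • y) - -c • (J y - c • y) ∈ Yᗮᗮ
    rw [hfactor]
    exact Submodule.smul_mem _ _ (Y.le_orthogonal_orthogonal hy.1)
  · have := hfactor y
    rw [h, map_zero, smul_zero, sub_zero, eq_comm, smul_eq_zero] at this
    exact this.resolve_left (sub_ne_zero.2 hc.symm)

theorem rank_compressedEigenspace_orthogonal (hJ : ∀ y, J (J y) = y) (hY : Yᗮᗮ = Y)
    (hc : c ^ 2 ≠ 1) :
    Module.rank 𝕜 (compressedEigenspace J Yᗮ c) =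
      Module.rank 𝕜 (compressedEigenspace J Y (-c)) := by
  have hle := rank_compressedEigenspace_le_orthogonal (Y := Yᗮ) hJ hc
  have hge := rank_compressedEigenspace_le_orthogonal (Y := Y) (c := -c) hJ (by rwa [neg_sq])
  rw [hY] at hle
  rw [neg_neg] at hge
  exact le_antisymm hle hge

theorem rank_compressedEigenspace_neg {U : End 𝕜 K} (hU : ∀ y, U (U y) = y)
    (hsymm : U.IsSymmetric) (hJU : ∀ y, J (U y) = -U (J y)) (hUY : Y ∈ End.invtSubmodule U)
    (c : 𝕜) :
    Module.rank 𝕜 (compressedEigenspace J Y c) =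
      Module.rank 𝕜 (compressedEigenspace J Y (-c)) := by
  have hle (c : 𝕜) : Module.rank 𝕜 (compressedEigenspace J Y c) ≤
      Module.rank 𝕜 (compressedEigenspace J Y (-c)) := by
    refine rank_le_rank_of_mapsTo_of_disjoint_ker U (fun y hy => ⟨hUY hy.1, ?_⟩)
      (LinearMap.disjoint_ker.2 fun y _ h => ?_)
    · have : J (U y) - -c • U y = -U (J y - c • y) := by
        rw [hJU, map_sub, map_smul]
        module
      change J (U y) - -c • U y ∈ Yᗮ
      rw [this, neg_mem_iff]
      exact hsymm.orthogonalComplement_mem_invtSubmodule hUY hy.2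
    · rw [← hU y, h, map_zero]
  have hge := hle (-c)
  rw [neg_neg] at hge
  exact le_antisymm (hle c) hge

variable [Y.HasOrthogonalProjection]

/-- The compression `y ↦ P (J y)` of `J` to `Y`, where `P` is the orthogonal projection
onto `Y`. -/
def compression (J : End 𝕜 K) (Y : Submodule 𝕜 K) [Y.HasOrthogonalProjection] :
    End 𝕜 Y :=
  Y.orthogonalProjectionOnto.toLinearMap ∘ₗ J ∘ₗ Y.subtype

theorem inner_compression (x y : Y) : inner 𝕜 x (compression J Y y) = inner 𝕜 (x : K) (J y) :=
  Submodule.inner_orthogonalProjectionOnto_eq_of_mem_left x (J y)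

theorem compression_isSymmetric (hsymm : J.IsSymmetric) : (compression J Y).IsSymmetric := by
  intro x y
  rw [inner_compression, ← hsymm, ← inner_conj_symm, inner_compression, inner_conj_symm]

theorem map_eigenspace_compression (c : 𝕜) :
    ((compression J Y).eigenspace c).map Y.subtype = compressedEigenspace J Y c := by
  have hmem (y : Y) : y ∈ (compression J Y).eigenspace c ↔ J y - c • (y : K) ∈ Yᗮ := by
    rw [End.mem_eigenspace_iff, ← Submodule.orthogonalProjectionOnto_eq_zero_iff, map_sub,
      map_smul, Submodule.orthogonalProjectionOnto_mem_subspace_eq_self, sub_eq_zero]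
    rfl
  ext y
  rw [mem_compressedEigenspace, Submodule.mem_map]
  constructor
  · rintro ⟨z, hz, rfl⟩
    exact ⟨z.2, (hmem z).1 hz⟩
  · rintro ⟨hy, h⟩
    exact ⟨⟨y, hy⟩, (hmem _).2 h, rfl⟩

theorem finrank_eigenspace_compression (c : 𝕜) :
    finrank 𝕜 ((compression J Y).eigenspace c) = finrank 𝕜 (compressedEigenspace J Y c) := by
  rw [← map_eigenspace_compression, Submodule.finrank_map_subtype_eq]

theorem commute_starProjection {U : End 𝕜 K} (hsymm : U.IsSymmetric)
    (hUY : Y ∈ End.invtSubmodule U) : Commute U (Y.starProjection : End 𝕜 K) := by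
  ext y
  have hmem : U (Y.starProjection y) ∈ Y := hUY (Y.starProjection_apply_mem y)
  have horth : U (y - Y.starProjection y) ∈ Yᗮ :=
    hsymm.orthogonalComplement_mem_invtSubmodule hUY (Y.sub_starProjection_mem_orthogonal y)
  rw [map_sub] at horth
  exact (Submodule.eq_starProjection_of_mem_orthogonal hmem horth).symm

-- With `P` the projection onto `Y`, `tr (P J) = ∑ tr (P J Uᵢ) = ∑ tr (Uᵢ P J Uᵢ)` and
-- `Uᵢ P J Uᵢ = P Uᵢ J Uᵢ = 0`.
theorem trace_compression_eq_zero [FiniteDimensional 𝕜 K] {ι : Type*} (s : Finset ι)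
    (U : ι → End 𝕜 K) (hsum : ∑ i ∈ s, U i = 1) (hidem : ∀ i, IsIdempotentElem (U i))
    (hsymm : ∀ i, (U i).IsSymmetric) (hUY : ∀ i, Y ∈ End.invtSubmodule (U i))
    (hUJU : ∀ i, U i * J * U i = 0) : LinearMap.trace 𝕜 Y (compression J Y) = 0 := by
  let P : End 𝕜 K := Y.starProjection
  have htrace : LinearMap.trace 𝕜 Y (compression J Y) = LinearMap.trace 𝕜 K (P * J) := by
    rw [LinearMap.trace_mul_comm]
    exact LinearMap.trace_comp_comm' (J ∘ₗ Y.subtype) Y.orthogonalProjectionOnto.toLinearMap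
  rw [htrace, ← mul_one (P * J), ← hsum, Finset.mul_sum, map_sum]
  refine Finset.sum_eq_zero fun i _ => ?_
  calc LinearMap.trace 𝕜 K (P * J * U i)
      = LinearMap.trace 𝕜 K (P * J * U i * U i) := by rw [mul_assoc _ (U i), (hidem i).eq]
    _ = LinearMap.trace 𝕜 K (U i * P * J * U i) := by
      rw [LinearMap.trace_mul_comm]
      simp only [mul_assoc]
    _ = LinearMap.trace 𝕜 K (P * (U i * J * U i)) := by
      have hcomm : U i * P = P * U i := (commute_starProjection (hsymm i) (hUY i)).eq
      rw [hcomm]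
      simp only [mul_assoc]
    _ = 0 := by rw [hUJU, mul_zero, map_zero]

end Compression

section Trace

variable {k E : Type*} [Field k] [AddCommGroup E] [Module k E] [FiniteDimensional k E]
  {A : End k E}

theorem support_mul_finrank_eigenspace_subset (A : End k E) :
    (Function.support fun c : k => c * finrank k (A.eigenspace c)) ⊆ {c | A.HasEigenvalue c} := by
  intro c hc h
  have hzero : finrank k (A.eigenspace c) = 0 := Submodule.finrank_eq_zero.2 h
  exact hc (by simp only [hzero, Nat.cast_zero, mul_zero])

theorem trace_eq_finsum_finrank_eigenspace (hA : ⨆ c, A.eigenspace c = ⊤) :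
    LinearMap.trace k E A = ∑ᶠ c, c * finrank k (A.eigenspace c) := by
  classical
  have hinternal : DirectSum.IsInternal A.eigenspace :=
    DirectSum.isInternal_submodule_of_iSupIndep_of_iSup_eq_top A.eigenspaces_iSupIndep hA
  have hmaps (c : k) : MapsTo A (A.eigenspace c) (A.eigenspace c) :=
    A.eigenspace_mem_invtSubmodule c
  have hrestrict (c : k) : A.restrict (hmaps c) = c • LinearMap.id := by
    ext x
    exact End.mem_eigenspace_iff.1 x.2
  rw [LinearMap.trace_eq_sum_trace_restrict' hinternal A.finite_hasEigenvalue hmaps,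
    finsum_eq_sum_of_support_subset_of_finite _ (support_mul_finrank_eigenspace_subset A)
      A.finite_hasEigenvalue]
  simp only [hrestrict, map_smul, LinearMap.trace_id, smul_eq_mul]
  rfl

theorem finrank_eigenspace_one_eq_neg_one [CharZero k] (hA : ⨆ c, A.eigenspace c = ⊤)
    (htrace : LinearMap.trace k E A = 0)
    (h : ∀ c : k, c ^ 2 ≠ 1 → finrank k (A.eigenspace c) = finrank k (A.eigenspace (-c))) :
    finrank k (A.eigenspace 1) = finrank k (A.eigenspace (-1)) := by
  classical
  let m (c : k) : k := finrank k (A.eigenspace c)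
  have hfin : (fun c => c * m c).HasFiniteSupport :=
    A.finite_hasEigenvalue.subset (support_mul_finrank_eigenspace_subset A)
  have hsum : ∑ᶠ c, c * m c = 0 := by rw [← htrace, trace_eq_finsum_finrank_eigenspace hA]
  have hsum_neg : ∑ᶠ c, -c * m (-c) = 0 := (finsum_comp_equiv (Equiv.neg k)).trans hsum
  have hsum_add : ∑ᶠ c, (c * m c + -c * m (-c)) = 0 := by
    rw [finsum_add_distrib hfin (hfin.preimage neg_injective.injOn), hsum, hsum_neg, add_zero]
  have hsupport : (Function.support fun c => c * m c + -c * m (-c)) ⊆ ({1, -1} : Finset k) := by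
    intro c hc
    contrapose! hc
    have : m c = m (-c) := congrArg Nat.cast (h c (by simpa using hc))
    rw [Function.notMem_support, this]
    ring
  rw [finsum_eq_sum_of_support_subset _ hsupport, Finset.sum_pair (by norm_num)] at hsum_add
  have : m 1 = m (-1) := by
    rw [neg_neg] at hsum_add
    linear_combination hsum_add / 2
  exact Nat.cast_injective this

end Trace

section Solutions

variable {H : Type*} [NormedAddCommGroup H] [InnerProductSpace ℂ H]
  {Y : Submodule ℂ (WithLp 2 (H × H))} {s μ : ℂ}

/-- The exchange of the two end points of the interval `[0, 1]`, on pairs of boundary values. -/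
def swap (H : Type*) [NormedAddCommGroup H] [InnerProductSpace ℂ H] :
    End ℂ (WithLp 2 (H × H)) :=
  (LinearIsometryEquiv.withLpProdComm 2 ℂ H H).toLinearEquiv

theorem swap_toLp (a b : H) : swap H (WithLp.toLp 2 (a, b)) = WithLp.toLp 2 (b, a) := rfl

theorem swap_swap (y : WithLp 2 (H × H)) : swap H (swap H y) = y := rfl

theorem swap_isSymmetric : (swap H).IsSymmetric := by
  intro y z
  rw [WithLp.prod_inner_apply, WithLp.prod_inner_apply]
  exact add_comm _ _

omit [InnerProductSpace ℂ H] in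
theorem extend_coe (u : C(unitInterval, H)) (x : unitInterval) : extend u x = u x :=
  IccExtend_val _ _ _

theorem hasDerivAt_cos_mul (s : ℂ) (x : ℝ) :
    HasDerivAt (fun x : ℝ => Complex.cos (s * x)) (-(s * Complex.sin (s * x))) x := by
  simpa [mul_comm] using (((hasDerivAt_id (x : ℂ)).const_mul s).ccos).comp_ofReal

theorem hasDerivAt_sin_mul (s : ℂ) (x : ℝ) :
    HasDerivAt (fun x : ℝ => Complex.sin (s * x)) (s * Complex.cos (s * x)) x := by
  simpa [mul_comm] using (((hasDerivAt_id (x : ℂ)).const_mul s).csin).comp_ofReal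

/-- The function `cos (s x) a + sin (s x) b` on `[0, 1]`. -/
def trig (s : ℂ) (a b : H) : C(unitInterval, H) where
  toFun x := Complex.cos (s * (x : ℝ)) • a + Complex.sin (s * (x : ℝ)) • b
  continuous_toFun := by fun_prop

theorem extend_trig (s : ℂ) (a b : H) {x : ℝ} (hx : x ∈ Icc (0 : ℝ) 1) :
    extend (trig s a b) x = Complex.cos (s * x) • a + Complex.sin (s * x) • b :=
  extend_coe (trig s a b) ⟨x, hx⟩

theorem isC2_trig (s : ℂ) (a b : H) : IsC2 (trig s a b) := by
  have hmul : ContDiff ℝ 2 fun x : ℝ => s * (x : ℂ) :=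
    contDiff_const.mul Complex.ofRealCLM.contDiff
  have hsmooth : ContDiff ℝ 2 fun x : ℝ =>
      Complex.cos (s * x) • a + Complex.sin (s * x) • b :=
    (((Complex.contDiff_cos.restrict_scalars ℝ).comp hmul).smul contDiff_const).add
      (((Complex.contDiff_sin.restrict_scalars ℝ).comp hmul).smul contDiff_const)
  exact hsmooth.contDiffOn.congr fun x hx => extend_trig s a b hx

theorem deriv₁_trig (s : ℂ) (a b : H) {x : ℝ} (hx : x ∈ Icc (0 : ℝ) 1) :
    deriv₁ (trig s a b) x = extend (trig s (s • b) (-(s • a))) x := by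
  have hderiv : HasDerivAt (fun x : ℝ => Complex.cos (s * x) • a + Complex.sin (s * x) • b)
      (Complex.cos (s * x) • (s • b) + Complex.sin (s * x) • (-(s • a))) x := by
    refine (((hasDerivAt_cos_mul s x).smul_const a).add
      ((hasDerivAt_sin_mul s x).smul_const b)).congr_deriv ?_
    module
  rw [deriv₁, derivWithin_congr (fun y hy => extend_trig s a b hy) (extend_trig s a b hx),
    extend_trig _ _ _ hx]
  exact hderiv.hasDerivWithinAt.derivWithin (uniqueDiffOn_Icc zero_lt_one x hx)

theorem deriv₂_trig (s : ℂ) (a b : H) {x : ℝ} (hx : x ∈ Icc (0 : ℝ) 1) :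
    deriv₂ (trig s a b) x = -(s ^ 2 • extend (trig s a b) x) := by
  rw [deriv₂, derivWithin_congr (fun y hy => deriv₁_trig s a b hy) (deriv₁_trig s a b hx)]
  refine (deriv₁_trig s _ _ hx).trans ?_
  rw [extend_trig _ _ _ hx, extend_trig _ _ _ hx]
  module

-- The function `t ↦ sin (s (x - t)) u' t + s cos (s (x - t)) u t` is constant; compare its values
-- at `t = x` and at `t = 0`.
theorem IsC2.smul_extend_eq {u : C(unitInterval, H)} (hu : IsC2 u)
    (hode : ∀ t ∈ Icc (0 : ℝ) 1, deriv₂ u t = -(s ^ 2 • extend u t)) {x : ℝ}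
    (hx : x ∈ Icc (0 : ℝ) 1) :
    s • extend u x =
      Complex.sin (s * x) • deriv₁ u 0 + (s * Complex.cos (s * x)) • extend u 0 := by
  let F (t : ℝ) : H := Complex.sin (s * (x - t : ℝ)) • deriv₁ u t +
    (s * Complex.cos (s * (x - t : ℝ))) • extend u t
  have hF (t : ℝ) (ht : t ∈ Icc (0 : ℝ) 1) : HasDerivWithinAt F 0 (Icc 0 1) t := by
    have hsin := ((hasDerivAt_sin_mul s (x - t)).comp_const_sub x t).hasDerivWithinAt.smul
      (hu.contDiff_deriv.differentiableOn one_ne_zero t ht).hasDerivWithinAt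
    have hcos := (((hasDerivAt_cos_mul s (x - t)).comp_const_sub x t).const_mul
      s).hasDerivWithinAt.smul (hu.diff t ht).hasDerivWithinAt
    refine (hsin.add hcos).congr_deriv ?_
    change _ • deriv₂ u t + _ + (_ • deriv₁ u t + _) = 0
    rw [hode t ht]
    module
  have hconst : F x = F 0 := constant_of_has_deriv_right_zero
    (fun t ht => (hF t ht).continuousWithinAt)
    (fun t ht => (hF t (Ico_subset_Icc_self ht)).mono_of_mem_nhdsWithin
      (Icc_mem_nhdsGE_of_mem ht)) x hx
  simpa [F] using hconst

theorem IsC2.eq_trig {u : C(unitInterval, H)} (hu : IsC2 u) (hs : s ≠ 0)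
    (hode : ∀ t ∈ Icc (0 : ℝ) 1, deriv₂ u t = -(s ^ 2 • extend u t)) :
    u = trig s (u 0) (s⁻¹ • deriv₁ u 0) := by
  refine ContinuousMap.ext fun x => smul_right_injective H hs ?_
  have hzero : extend u 0 = u 0 := extend_coe u 0
  have hx := hu.smul_extend_eq hode x.2
  rw [extend_coe, hzero] at hx
  change s • u x = s • (Complex.cos (s * (x : ℝ)) • u 0 +
    Complex.sin (s * (x : ℝ)) • s⁻¹ • deriv₁ u 0)
  rw [hx, smul_add, smul_comm s (Complex.sin _), smul_inv_smul₀ hs]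
  module

theorem boundaryValues_trig (s : ℂ) (a b : H) :
    boundaryValues (trig s a b) =
      WithLp.toLp 2 (a, Complex.cos s • a + Complex.sin s • b) := by
  simp [boundaryValues, trig]

theorem sin_smul_boundaryDerivs_trig (s : ℂ) (a b : H) :
    Complex.sin s • boundaryDerivs (trig s a b) =
      -s • (swap H (boundaryValues (trig s a b)) -
        Complex.cos s • boundaryValues (trig s a b)) := by
  have hleft : Complex.sin s • -(s • b) =
      -s • (Complex.cos s • a + Complex.sin s • b - Complex.cos s • a) := by
    module
  have hright : Complex.sin s • (Complex.cos s • (s • b) + Complex.sin s • -(s • a)) =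
      -s • (a - Complex.cos s • (Complex.cos s • a + Complex.sin s • b)) := by
    linear_combination (norm := module) (-s * Complex.sin_sq_add_cos_sq s) • a
  rw [boundaryDerivs, deriv₁_trig _ _ _ (left_mem_Icc.2 zero_le_one),
    deriv₁_trig _ _ _ (right_mem_Icc.2 zero_le_one), boundaryValues_trig,
    swap_toLp]
  refine WithLp.ofLp_injective 2 (Prod.ext ?_ ?_)
  · simpa [extend_trig] using hleft
  · simpa [extend_trig] using hright

theorem mem_eigenspace_neg_laplacian {u : (-laplacian Y).domain} :
    u ∈ eigenspace (-laplacian Y) μ ↔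
      ∀ x ∈ Icc (0 : ℝ) 1, deriv₂ u.1 x = -(μ • extend u.1 x) := by
  rw [eigenspace, LinearMap.mem_ker, LinearMap.sub_apply, sub_eq_zero, ContinuousMap.ext_iff,
    Subtype.forall]
  refine forall₂_congr fun x hx => ?_
  change -deriv₂ u.1 x = μ • u.1 ⟨x, hx⟩ ↔ _
  rw [neg_eq_iff_eq_neg, ← extend_coe]

theorem trig_mem_domain_iff (hs : Complex.sin s ≠ 0) (a b : H) :
    trig s a b ∈ domain Y ↔
      boundaryValues (trig s a b) ∈ compressedEigenspace (swap H) Y (Complex.cos s) := by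
  have hs₀ : -s ≠ 0 := neg_ne_zero.2 fun h => hs (by rw [h, Complex.sin_zero])
  rw [mem_compressedEigenspace, ← Yᗮ.smul_mem_iff hs₀, ← sin_smul_boundaryDerivs_trig,
    Yᗮ.smul_mem_iff hs]
  exact and_iff_right (isC2_trig s a b)

/-- The boundary values of an eigenfunction of `-laplacian Y`, as a linear map. -/
def eigenspaceBoundaryValues (Y : Submodule ℂ (WithLp 2 (H × H))) (μ : ℂ) :
    eigenspace (-laplacian Y) μ →ₗ[ℂ] WithLp 2 (H × H) where
  toFun u := boundaryValues u.1.1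
  map_add' _ _ := rfl
  map_smul' _ _ := rfl

theorem exists_eq_trig_of_mem_eigenspace (hs : s ≠ 0)
    (u : eigenspace (-laplacian Y) (s ^ 2)) : ∃ a b, u.1.1 = trig s a b :=
  ⟨_, _, u.1.2.1.eq_trig hs (mem_eigenspace_neg_laplacian.1 u.2)⟩

theorem eigenspaceBoundaryValues_injective (hs : Complex.sin s ≠ 0) :
    Function.Injective (eigenspaceBoundaryValues Y (s ^ 2)) := by
  have hs₀ : s ≠ 0 := fun h => hs (by rw [h, Complex.sin_zero])
  rw [injective_iff_map_eq_zero]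
  intro u hu
  obtain ⟨a, b, hab⟩ := exists_eq_trig_of_mem_eigenspace hs₀ u
  have hbv : boundaryValues u.1.1 = 0 := hu
  rw [hab, boundaryValues_trig] at hbv
  have ha : a = 0 := congrArg WithLp.fst hbv
  have hb : Complex.cos s • a + Complex.sin s • b = 0 := congrArg WithLp.snd hbv
  rw [ha, smul_zero, zero_add, smul_eq_zero, or_iff_right hs] at hb
  refine Subtype.ext (Subtype.ext (hab.trans (ContinuousMap.ext fun x => ?_)))
  simp [trig, ha, hb]

theorem range_eigenspaceBoundaryValues (hs : Complex.sin s ≠ 0) :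
    LinearMap.range (eigenspaceBoundaryValues Y (s ^ 2)) =
      compressedEigenspace (swap H) Y (Complex.cos s) := by
  have hs₀ : s ≠ 0 := fun h => hs (by rw [h, Complex.sin_zero])
  ext y
  constructor
  · rintro ⟨u, rfl⟩
    obtain ⟨a, b, hab⟩ := exists_eq_trig_of_mem_eigenspace hs₀ u
    change boundaryValues u.1.1 ∈ _
    rw [hab, ← trig_mem_domain_iff hs, ← hab]
    exact u.1.2
  · intro hy
    let b := (Complex.sin s)⁻¹ • (y.snd - Complex.cos s • y.fst)
    have hbv : boundaryValues (trig s y.fst b) = y := by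
      rw [boundaryValues_trig, smul_inv_smul₀ hs, add_sub_cancel]
      rfl
    have hdomain : trig s y.fst b ∈ domain Y := (trig_mem_domain_iff hs _ _).2 (by rwa [hbv])
    exact ⟨⟨⟨_, hdomain⟩, mem_eigenspace_neg_laplacian.2 fun x hx => deriv₂_trig _ _ _ hx⟩, hbv⟩

theorem sqrt_sq (μ : ℂ) : Complex.sqrt μ ^ 2 = μ := by
  rw [Complex.sqrt]
  exact_mod_cast Complex.cpow_nat_inv_pow μ two_ne_zero

theorem multiplicity_neg_laplacian (hμ : Complex.sin (Complex.sqrt μ) ≠ 0) :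
    multiplicity (-laplacian Y) μ =
      Module.rank ℂ (compressedEigenspace (swap H) Y (Complex.cos (Complex.sqrt μ))) := by
  have hinj := eigenspaceBoundaryValues_injective (Y := Y) hμ
  rw [← range_eigenspaceBoundaryValues hμ]
  rw [sqrt_sq] at hinj ⊢
  exact (LinearEquiv.ofInjective _ hinj).rank_eq

end Solutions

section Graph

variable {V : Type*} {G : SimpleGraph V} {φ : V → ℂ} {c : ℂ}

theorem sq_eq_sq_of_reachable {R : Type*} [CommMonoid R] {φ : V → R} {c : R} (hc : c ^ 2 = 1)
    (hφ : ∀ v w, G.Adj v w → φ w = c * φ v) {v w : V} (h : G.Reachable v w) :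
    φ w ^ 2 = φ v ^ 2 := by
  rw [SimpleGraph.reachable_iff_reflTransGen] at h
  induction h with
  | refl => rfl
  | tail _ hadj ih => rw [hφ _ _ hadj, mul_pow, hc, one_mul, ih]

variable (G) in
/-- The Hilbert space `ℂ^E × ℂ^E` of pairs of boundary values. -/
abbrev BoundarySpace : Type _ :=
  WithLp 2 (EuclideanSpace ℂ G.edgeSet × EuclideanSpace ℂ G.edgeSet)

theorem BoundarySpace.ext {y z : BoundarySpace G}
    (hfst : ∀ e, y.fst e = z.fst e) (hsnd : ∀ e, y.snd e = z.snd e) : y = z :=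
  WithLp.ofLp_injective 2 (Prod.ext (PiLp.ext hfst) (PiLp.ext hsnd))

variable (P : EdgeParametrization G)

/-- Multiplication of boundary values by a function on the vertices. -/
def vertexMul : (V → ℂ) →ₐ[ℂ] End ℂ (BoundarySpace G) where
  toFun f :=
    { toFun := fun y => WithLp.toLp 2 (WithLp.toLp 2 fun e => f (P.tail e) * y.fst e,
        WithLp.toLp 2 fun e => f (P.head e) * y.snd e)
      map_add' := fun _ _ => BoundarySpace.ext (fun _ => mul_add _ _ _) fun _ => mul_add _ _ _
      map_smul' := fun _ _ =>
        BoundarySpace.ext (fun _ => mul_left_comm _ _ _) fun _ => mul_left_comm _ _ _ }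
  map_one' := LinearMap.ext fun _ => BoundarySpace.ext (fun _ => one_mul _) fun _ => one_mul _
  map_mul' _ _ := LinearMap.ext fun _ =>
    BoundarySpace.ext (fun _ => mul_assoc _ _ _) fun _ => mul_assoc _ _ _
  map_zero' := LinearMap.ext fun _ => BoundarySpace.ext (fun _ => zero_mul _) fun _ => zero_mul _
  map_add' _ _ := LinearMap.ext fun _ =>
    BoundarySpace.ext (fun _ => add_mul _ _ _) fun _ => add_mul _ _ _
  commutes' _ := rfl

theorem range_endValues_mem_invtSubmodule_vertexMul (f : V → ℂ) :
    LinearMap.range (endValues P) ∈ End.invtSubmodule (vertexMul P f) := by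
  rintro _ ⟨φ, rfl⟩
  exact ⟨f * φ, rfl⟩

/-- The connected components that contain an edge, that is, those that are not a single vertex. -/
def edgeComponents : Set G.ConnectedComponent :=
  range fun e => G.connectedComponentMk (P.tail e)

/-- The boundary values at the initial end of one chosen edge in each component of
`edgeComponents P`. -/
def componentValues : BoundarySpace G →ₗ[ℂ] (edgeComponents P → ℂ) where
  toFun y C := y.fst C.2.choose
  map_add' _ _ := rfl
  map_smul' _ _ := rfl

theorem sq_tail_eq_of_componentValues_eq (hc : c ^ 2 = 1) (hφ : ∀ v w, G.Adj v w → φ w = c * φ v)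
    {a : ℂ} (ha : ∀ C, componentValues P (endValues P φ) C = a) (e : G.edgeSet) :
    φ (P.tail e) ^ 2 = a ^ 2 := by
  let C : edgeComponents P := ⟨_, mem_range_self e⟩
  have hreach : G.Reachable (P.tail C.2.choose) (P.tail e) :=
    SimpleGraph.ConnectedComponent.exact C.2.choose_spec
  rw [sq_eq_sq_of_reachable hc hφ hreach, ← ha C]
  rfl

variable [Fintype G.edgeSet]

/-- The eigenspace at `c` of the compression to the range of `endValues P` of the exchange of the
two ends of every edge. This compression is the transition operator of the random walk on `G`, a
vertex function `φ` being represented by `endValues P φ`. -/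
abbrev transitionEigenspace (c : ℂ) : Submodule ℂ (BoundarySpace G) :=
  compressedEigenspace (swap (EuclideanSpace ℂ G.edgeSet)) (LinearMap.range (endValues P)) c

theorem vertexMul_isSymmetric {f : V → ℂ} (hf : star f = f) : (vertexMul P f).IsSymmetric := by
  have hmul (v : V) (a b : ℂ) : inner ℂ (f v * a) b = inner ℂ a (f v * b) := by
    have hv : star (f v) = f v := congrFun hf v
    change b * star (f v * a) = f v * b * star a
    rw [star_mul, hv]
    ring
  intro y z
  rw [WithLp.prod_inner_apply, WithLp.prod_inner_apply]
  simp only [PiLp.inner_apply]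
  exact congrArg₂ (· + ·) (Finset.sum_congr rfl fun e _ => hmul _ _ _)
    (Finset.sum_congr rfl fun e _ => hmul _ _ _)

theorem vertexMul_mul_swap_mul_vertexMul_eq_zero {f g : V → ℂ}
    (h : ∀ v w, G.Adj v w → f v * g w = 0) :
    vertexMul P f * swap (EuclideanSpace ℂ G.edgeSet) * vertexMul P g = 0 := by
  refine LinearMap.ext fun y => BoundarySpace.ext (fun e => ?_) fun e => ?_
  · change f (P.tail e) * (g (P.head e) * y.snd e) = 0
    rw [← mul_assoc, h _ _ (P.adj e), zero_mul]
  · change f (P.head e) * (g (P.tail e) * y.fst e) = 0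
    rw [← mul_assoc, h _ _ (P.adj e).symm, zero_mul]

theorem swap_vertexMul_eq_neg {f : V → ℂ} (h : ∀ v w, G.Adj v w → f w = -f v)
    (y : BoundarySpace G) :
    swap (EuclideanSpace ℂ G.edgeSet) (vertexMul P f y) =
      -vertexMul P f (swap (EuclideanSpace ℂ G.edgeSet) y) := by
  refine BoundarySpace.ext (fun e => ?_) fun e => ?_
  · change f (P.head e) * y.snd e = -(f (P.tail e) * y.snd e)
    rw [h _ _ (P.adj e), neg_mul]
  · change f (P.tail e) * y.fst e = -(f (P.head e) * y.fst e)
    rw [h _ _ (P.adj e).symm, neg_mul]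

-- A random walk on a simple graph never stays put, so its transition operator has zero diagonal.
theorem trace_compression_swap_eq_zero :
    LinearMap.trace ℂ _ (compression (swap (EuclideanSpace ℂ G.edgeSet))
      (LinearMap.range (endValues P))) = 0 := by
  classical
  let s : Finset V := Finset.univ.image P.tail ∪ Finset.univ.image P.head
  have hone (v : V) (hv : v ∈ s) : (∑ w ∈ s, Pi.single w (1 : ℂ)) v = 1 := by
    rw [Finset.sum_apply, Finset.sum_pi_single, if_pos hv]
  refine trace_compression_eq_zero s (fun v => vertexMul P (Pi.single v 1)) ?_ (fun v => ?_)
    (fun v => vertexMul_isSymmetric P ?_) (fun v => range_endValues_mem_invtSubmodule_vertexMul P _)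
    fun v => vertexMul_mul_swap_mul_vertexMul_eq_zero P fun w x hwx => ?_
  · rw [← map_sum]
    refine LinearMap.ext fun y => BoundarySpace.ext (fun e => ?_) fun e => ?_
    · change (∑ w ∈ s, Pi.single w (1 : ℂ)) (P.tail e) * y.fst e = y.fst e
      rw [hone _ (by simp [s]), one_mul]
    · change (∑ w ∈ s, Pi.single w (1 : ℂ)) (P.head e) * y.snd e = y.snd e
      rw [hone _ (by simp [s]), one_mul]
  · rw [IsIdempotentElem, ← map_mul, ← Pi.single_mul, mul_one]
  · rw [← Pi.single_star, star_one]
  · rcases eq_or_ne w v with rfl | hw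
    · rw [Pi.single_eq_of_ne hwx.ne', mul_zero]
    · rw [Pi.single_eq_of_ne hw, zero_mul]

theorem mem_transitionEigenspace_iff_of_sq_eq_one (hc : c ^ 2 = 1) {y : BoundarySpace G} :
    y ∈ transitionEigenspace P c ↔
      ∃ φ : V → ℂ, (∀ v w, G.Adj v w → φ w = c * φ v) ∧ endValues P φ = y := by
  rw [mem_compressedEigenspace_of_sq_eq_one swap_swap swap_isSymmetric hc]
  constructor
  · rintro ⟨⟨φ, rfl⟩, hφ⟩
    refine ⟨φ, fun v w hvw => ?_, rfl⟩
    obtain ⟨e, ⟨rfl, rfl⟩ | ⟨rfl, rfl⟩⟩ := P.exists_edge hvw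
    · exact congrArg (fun y : BoundarySpace G => y.fst e) hφ
    · exact congrArg (fun y : BoundarySpace G => y.snd e) hφ
  · rintro ⟨φ, hφ, rfl⟩
    exact ⟨⟨φ, rfl⟩, BoundarySpace.ext (fun e => hφ _ _ (P.adj e))
      fun e => hφ _ _ (P.adj e).symm⟩

theorem componentValues_injective (hc : c ^ 2 = 1) :
    Function.Injective ((componentValues P).domRestrict (transitionEigenspace P c)) := by
  rw [injective_iff_map_eq_zero]
  rintro ⟨y, hy⟩ hzero
  obtain ⟨φ, hφ, rfl⟩ := (mem_transitionEigenspace_iff_of_sq_eq_one P hc).1 hy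
  have htail (e : G.edgeSet) : φ (P.tail e) = 0 := by
    have hsq := sq_tail_eq_of_componentValues_eq P hc hφ (a := 0) (congrFun hzero) e
    rwa [zero_pow two_ne_zero, sq_eq_zero_iff] at hsq
  refine Subtype.ext (BoundarySpace.ext htail fun e => ?_)
  change φ (P.head e) = 0
  rw [hφ _ _ (P.adj e), htail, mul_zero]

theorem componentValues_surjective_of_one :
    Function.Surjective ((componentValues P).domRestrict (transitionEigenspace P 1)) := by
  classical
  intro g
  let φ (v : V) : ℂ :=
    if hv : G.connectedComponentMk v ∈ edgeComponents P then g ⟨_, hv⟩ else 0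
  have hφ (v w : V) (hvw : G.Adj v w) : φ w = 1 * φ v := by
    simp only [φ, one_mul, SimpleGraph.ConnectedComponent.sound hvw.reachable]
  refine ⟨⟨endValues P φ,
    (mem_transitionEigenspace_iff_of_sq_eq_one P (one_pow 2)).2 ⟨φ, hφ, rfl⟩⟩, funext fun C => ?_⟩
  change φ (P.tail C.2.choose) = g C
  have hC : G.connectedComponentMk (P.tail C.2.choose) = C := C.2.choose_spec
  simp only [φ, hC, C.2, dite_true]

theorem isBipartite_of_componentValues_surjective
    (h : Function.Surjective ((componentValues P).domRestrict (transitionEigenspace P (-1)))) :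
    G.IsBipartite := by
  classical
  obtain ⟨⟨y, hy⟩, hone⟩ := h 1
  obtain ⟨φ, hφ, rfl⟩ := (mem_transitionEigenspace_iff_of_sq_eq_one P (by norm_num)).1 hy
  let color (v : V) : Fin 2 := if φ v = 1 then 0 else 1
  have hedge (e : G.edgeSet) : color (P.tail e) ≠ color (P.head e) := by
    have hhead := hφ _ _ (P.adj e)
    have hsq := sq_tail_eq_of_componentValues_eq P (by norm_num) hφ (a := 1) (congrFun hone) e
    rcases sq_eq_sq_iff_eq_or_eq_neg.1 hsq with htail | htail <;>
      norm_num [color, hhead, htail]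
  refine ⟨SimpleGraph.Coloring.mk color fun hvw => ?_⟩
  obtain ⟨e, ⟨rfl, rfl⟩ | ⟨rfl, rfl⟩⟩ := P.exists_edge hvw
  · exact hedge e
  · exact (hedge e).symm

theorem isBipartite_of_finrank_transitionEigenspace_eq
    (h : finrank ℂ (transitionEigenspace P 1) = finrank ℂ (transitionEigenspace P (-1))) :
    G.IsBipartite := by
  have hfinite : Finite (edgeComponents P) := finite_range _
  have hinj := componentValues_injective P (c := -1) (by norm_num)
  have hone : finrank ℂ (transitionEigenspace P 1) = finrank ℂ (edgeComponents P → ℂ) :=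
    (LinearEquiv.ofBijective _ ⟨componentValues_injective P (one_pow 2),
      componentValues_surjective_of_one P⟩).finrank_eq
  exact isBipartite_of_componentValues_surjective P
    ((LinearMap.injective_iff_surjective_of_finrank_eq_finrank (h.symm.trans hone)).1 hinj)

theorem rank_transitionEigenspace_neg_of_isBipartite (hG : G.IsBipartite) (c : ℂ) :
    Module.rank ℂ (transitionEigenspace P c) = Module.rank ℂ (transitionEigenspace P (-c)) := by
  obtain ⟨color⟩ := hG
  let sign (v : V) : ℂ := if color v = 0 then 1 else -1
  have hsq : sign * sign = 1 := by
    funext v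
    by_cases hv : color v = 0 <;> simp [sign, hv]
  have hstar : star sign = sign := by
    funext v
    by_cases hv : color v = 0 <;> simp [sign, hv]
  have hneg (v w : V) (hvw : G.Adj v w) : sign w = -sign v := by
    have hcolor : color v ≠ color w := color.valid hvw
    have hw : color w = 0 ↔ color v ≠ 0 := by omega
    by_cases hv : color v = 0 <;> simp [sign, hw, hv]
  refine rank_compressedEigenspace_neg (U := vertexMul P sign) (fun y => ?_)
    (vertexMul_isSymmetric P hstar) (swap_vertexMul_eq_neg P hneg)
    (range_endValues_mem_invtSubmodule_vertexMul P sign) c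
  rw [← End.mul_apply, ← map_mul, hsq, map_one, End.one_apply]

-- The transition operator has trace `0`, so a spectrum that is symmetric away from `1` and `-1` is
-- symmetric.
theorem isBipartite_iff_rank_transitionEigenspace :
    G.IsBipartite ↔ ∀ c : ℂ, c ^ 2 ≠ 1 →
      Module.rank ℂ (transitionEigenspace P c) = Module.rank ℂ (transitionEigenspace P (-c)) := by
  refine ⟨fun hG c _ => rank_transitionEigenspace_neg_of_isBipartite P hG c, fun h => ?_⟩
  refine isBipartite_of_finrank_transitionEigenspace_eq P ?_
  have hsymm := compression_isSymmetric (Y := LinearMap.range (endValues P)) swap_isSymmetric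
  have htop : ⨆ c, (compression (swap (EuclideanSpace ℂ G.edgeSet))
      (LinearMap.range (endValues P))).eigenspace c = ⊤ := by
    rw [← Submodule.orthogonal_eq_bot_iff]
    exact hsymm.orthogonalComplement_iSup_eigenspaces_eq_bot
  have hspectrum := finrank_eigenspace_one_eq_neg_one htop (trace_compression_swap_eq_zero P)
  simp only [finrank_eigenspace_compression] at hspectrum
  exact hspectrum fun c hc => congrArg Cardinal.toNat (h c hc)

end Graph

section Immanent

theorem cos_sqrt_surjective : Function.Surjective fun μ => Complex.cos (Complex.sqrt μ) := by
  intro c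
  obtain ⟨s, rfl⟩ := Complex.cos_surjective c
  refine ⟨s ^ 2, ?_⟩
  rcases sq_eq_sq_iff_eq_or_eq_neg.1 (sqrt_sq (s ^ 2)) with h | h <;>
    simp only [h, Complex.cos_neg]

theorem sin_ne_zero_iff_cos_sq_ne_one {z : ℂ} : Complex.sin z ≠ 0 ↔ Complex.cos z ^ 2 ≠ 1 := by
  rw [Complex.cos_sq', Ne, Ne, sub_eq_self, sq_eq_zero_iff]

variable {X : Type*} [AddCommGroup X] [Module ℂ X] {S T : X →ₗ.[ℂ] X} {μ : ℂ}

theorem mem_immanentEigenvalues_iff :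
    μ ∈ immanentEigenvalues T ↔ multiplicity T μ ≠ 0 ∧ Complex.sin (Complex.sqrt μ) ≠ 0 := by
  rw [multiplicity, Ne, Submodule.rank_eq_zero]
  rfl

theorem same_immanentEigenvalues_iff :
    (immanentEigenvalues S = immanentEigenvalues T ∧
        ∀ μ ∈ immanentEigenvalues S, multiplicity S μ = multiplicity T μ) ↔
      ∀ μ, Complex.sin (Complex.sqrt μ) ≠ 0 → multiplicity S μ = multiplicity T μ := by
  constructor
  · rintro ⟨heq, hmult⟩ μ hμ
    by_cases hS : μ ∈ immanentEigenvalues S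
    · exact hmult μ hS
    · have hT := heq ▸ hS
      rw [mem_immanentEigenvalues_iff, and_iff_left hμ, not_not] at hS hT
      rw [hS, hT]
  · intro h
    refine ⟨Set.ext fun μ => ?_, fun μ hμ => h μ hμ.2⟩
    rw [mem_immanentEigenvalues_iff, mem_immanentEigenvalues_iff]
    exact and_congr_left fun hμ => by rw [h μ hμ]

variable {V : Type*} {G : SimpleGraph V} [Fintype G.edgeSet] (P : EdgeParametrization G)

theorem multiplicity_neg_laplacianCK (hμ : Complex.sin (Complex.sqrt μ) ≠ 0) :
    multiplicity (-laplacianCK P) μ =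
      Module.rank ℂ (transitionEigenspace P (Complex.cos (Complex.sqrt μ))) :=
  multiplicity_neg_laplacian hμ

theorem multiplicity_neg_laplacianKC (hμ : Complex.sin (Complex.sqrt μ) ≠ 0) :
    multiplicity (-laplacianKC P) μ =
      Module.rank ℂ (transitionEigenspace P (-Complex.cos (Complex.sqrt μ))) :=
  (multiplicity_neg_laplacian hμ).trans (rank_compressedEigenspace_orthogonal swap_swap
    (Submodule.orthogonal_orthogonal _) (sin_ne_zero_iff_cos_sq_ne_one.1 hμ))

end Immanent

end

end Network

theorem corollary4p5_general {V : Type*} (G : SimpleGraph V) [Fintype G.edgeSet]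
    (P : EdgeParametrization G) :
    G.IsBipartite ↔
      Network.immanentEigenvalues (-Network.laplacianCK P) =
          Network.immanentEigenvalues (-Network.laplacianKC P) ∧
        ∀ μ ∈ Network.immanentEigenvalues (-Network.laplacianCK P),
          Network.multiplicity (-Network.laplacianCK P) μ =
            Network.multiplicity (-Network.laplacianKC P) μ := by
  rw [Network.same_immanentEigenvalues_iff, Network.isBipartite_iff_rank_transitionEigenspace P,
    Network.cos_sqrt_surjective.forall]
  refine forall_congr' fun μ => ?_
  rw [← Network.sin_ne_zero_iff_cos_sq_ne_one]
  refine forall_congr' fun hμ => ?_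
  rw [Network.multiplicity_neg_laplacianCK P hμ, Network.multiplicity_neg_laplacianKC P hμ]

theorem corollary4p5 {V : Type*} [Fintype V] (G : SimpleGraph V) [Fintype G.edgeSet]
    (P : EdgeParametrization G) :
    G.IsBipartite ↔
      Network.immanentEigenvalues (-Network.laplacianCK P) =
          Network.immanentEigenvalues (-Network.laplacianKC P) ∧
        ∀ μ ∈ Network.immanentEigenvalues (-Network.laplacianCK P),
          Network.multiplicity (-Network.laplacianCK P) μ =
            Network.multiplicity (-Network.laplacianKC P) μ :=
  corollary4p5_general G P
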